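/- Let $N,L\ge 0$ be integers. For tensor factors $s\neq t$ put $R_{st}(\lambda)=\lambda\,\mathbb I+i\,\mathcal P_{st}$, where $\mathcal P_{st}=\sum_{i,j=1}^{N}(E_{ij})_s(E_{ji})_t$ is the permutation operator and $A_s$ denotes an $N\times N$ matrix $A$ acting in factor $s$. Let $K:\mathbb C\to M_N(\mathbb C)$ be a soliton-preserving reflection matrix, i.e. on $\mathbb C^N_a\otimes\mathbb C^N_b$, for all $x,y\in\mathbb C$, $$R_{ab}(x-y)\,K_a(x)\,R_{ba}(x+y)\,K_b(y)=K_b(y)\,R_{ab}(x+y)\,K_a(x)\,R_{ba}(x-y),$$ and suppose that $K(\lambda)$ is diagonalizable for every $\lambda\in\mathbb C$. For a matrix function $M:\mathbb C\to M_N(\mathbb C)$ define, on $(\mathbb C^N)^{\otimes L}$ (factors $1,\dots,L$), the transfer matrix (with $K^+=\mathbb I$) $$t_M(\lambda)=\mathrm{Tr}_a\bigl(R_{aL}(\lambda)\cdots R_{a1}(\lambda)\,M_a(\lambda)\,R_{1a}(\lambda)\cdots R_{La}(\lambda)\bigr).$$ Then there is a constant (independent of $\lambda$) matrix $U\in GL_N(\mathbb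 C)$ such that $U^{-1}K(\lambda)U$ is diagonal for all $\lambda\in\mathbb C$. Moreover, for every constant $U\in GL_N(\mathbb C)$ such that $D(\lambda)=U^{-1}K(\lambda)U$ is diagonal for all $\lambda\in\mathbb C$: $D$ is a soliton-preserving reflection matrix; the operator $U_1U_2\cdots U_L$ is invertible; and for every $\lambda\in\mathbb C$ $$t_K(\lambda)=(U_1\cdots U_L)\,t_D(\lambda)\,(U_1\cdots U_L)^{-1}.$$ In particular $t_K(\lambda)$ and $t_D(\lambda)$ have the same eigenvalues, and, for every $\mu\in\mathbb C$, the eigenvectors of $t_K(\lambda)$ with eigenvalue $\mu$ are exactly the vectors $v_K=U_1\cdots U_L\,v_D$ with $v_D$ an eigenvector of $t_D(\lambda)$ with eigenvalue $\mu$. -/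

import Mathlib

namespace OpenChain

open Matrix

/-- Operators on the tensor product `⨂_{s ∈ S} ℂ^N`, as matrices in the tensor basis
`e_f = ⨂_s e_{f s}`, indexed by `f : S → Fin N`. -/
abbrev TensorOp (S : Type) (N : ℕ) : Type :=
  Matrix (S → Fin N) (S → Fin N) ℂ

section Sites

variable {S : Type} [Fintype S] [DecidableEq S] {N : ℕ}

/-- `A_s`: the matrix `A` acting in the tensor factor `s`, and the identity in the others. -/
def siteOp (s : S) (A : Matrix (Fin N) (Fin N) ℂ) : TensorOp S N :=
  Matrix.of fun f g => if ∀ t, t ≠ s → f t = g t then A (f s) (g s) else 0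

/-- The permutation operator `P_{st} = ∑_{i,j} (E_{ij})_s (E_{ji})_t` (used for `s ≠ t`). -/
def permOp (s t : S) : TensorOp S N :=
  ∑ i : Fin N, ∑ j : Fin N,
    siteOp s (Matrix.single i j (1 : ℂ)) * siteOp t (Matrix.single j i (1 : ℂ))

/-- The rational `R` matrix `R_{st}(u) = u 𝕀 + i P_{st}`. -/
def rMatrix (s t : S) (u : ℂ) : TensorOp S N :=
  u • (1 : TensorOp S N) + Complex.I • permOp s t

end Sites

/-- `K` is a soliton-preserving reflection matrix: in `ℂ^N ⊗ ℂ^N` (factors `a = 0`, `b = 1`),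
`R_ab(x - y) K_a(x) R_ba(x + y) K_b(y) = K_b(y) R_ab(x + y) K_a(x) R_ba(x - y)`
for all values `x`, `y` of the spectral parameters. -/
def IsReflectionMatrix {N : ℕ} (K : ℂ → Matrix (Fin N) (Fin N) ℂ) : Prop :=
  ∀ x y : ℂ,
    (rMatrix (0 : Fin 2) 1 (x - y) * siteOp 0 (K x) * rMatrix 1 0 (x + y) * siteOp 1 (K y) :
        TensorOp (Fin 2) N)
      = siteOp 1 (K y) * rMatrix 0 1 (x + y) * siteOp 0 (K x) * rMatrix 1 0 (x - y)

/-- A complex square matrix is diagonalizable if it is similar to a diagonal matrix. -/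
def IsDiagonalizable {N : ℕ} (M : Matrix (Fin N) (Fin N) ℂ) : Prop :=
  ∃ Q : GeneralLinearGroup (Fin N) ℂ,
    (((Q⁻¹ : GeneralLinearGroup (Fin N) ℂ) : Matrix (Fin N) (Fin N) ℂ) * M *
      (Q : Matrix (Fin N) (Fin N) ℂ)).IsDiag

section Chain

variable {N : ℕ} (L : ℕ)

/-- `T_a(u) = R_{aL}(u) ⋯ R_{a1}(u)` on `ℂ^N ⊗ (ℂ^N)^{⊗ L}`; the factor `0` is the auxiliary
space `a`, and the factors `1, …, L` are the sites of the chain. -/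
def monodromy (u : ℂ) : TensorOp (Fin (L + 1)) N :=
  (List.ofFn fun j : Fin L => (rMatrix 0 j.rev.succ u : TensorOp (Fin (L + 1)) N)).prod

/-- `T̂_a(u) = R_{1a}(u) ⋯ R_{La}(u)`. -/
def monodromyHat (u : ℂ) : TensorOp (Fin (L + 1)) N :=
  (List.ofFn fun j : Fin L => (rMatrix j.succ 0 u : TensorOp (Fin (L + 1)) N)).prod

variable {L}

/-- The partial trace `Tr_a` over the auxiliary factor `0`. -/
def auxTrace (M : TensorOp (Fin (L + 1)) N) : TensorOp (Fin L) N :=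
  Matrix.of fun f g =>
    ∑ i : Fin N, M (Fin.cons (α := fun _ => Fin N) i f) (Fin.cons (α := fun _ => Fin N) i g)

variable (L)

/-- The soliton-preserving open chain transfer matrix with `K⁻ = K` and `K⁺ = 𝕀`:
`t_K(u) = Tr_a (T_a(u) K_a(u) T̂_a(u))`. -/
def transfer (K : ℂ → Matrix (Fin N) (Fin N) ℂ) (u : ℂ) : TensorOp (Fin L) N :=
  auxTrace (monodromy L u * siteOp 0 (K u) * monodromyHat L u)

/-- `U_1 U_2 ⋯ U_L` on `(ℂ^N)^{⊗ L}`. -/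
def chainOp (U : Matrix (Fin N) (Fin N) ℂ) : TensorOp (Fin L) N :=
  (List.ofFn fun j : Fin L => (siteOp j U : TensorOp (Fin L) N)).prod

end Chain

end OpenChain

/-! The core is that the reflection equation forces `K x` and `K y` to commute. Expanding both sides
leaves terms linear in the permutation operator and terms without it. Taking the partial trace over
either factor and adding the two results cancels the terms in `x + y` and, by cyclicity of the
trace, the terms `trace (K x * K y)`. What remains is `((x - y) * N + 2i)` times the commutator
(`IsReflectionMatrix.smul_commutator`). A commuting family of diagonalizable matrices then has a
common eigenbasis (`exists_simultaneous_diagonalization`).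

The rest is `GL_N` covariance. The operator `U ⊗ ⋯ ⊗ U` commutes with every R-matrix and intertwines
`K_a` with `D_a`, and its auxiliary factor disappears under the partial trace (`auxTrace_conj`).
This gives the similarity of transfer matrices (`transfer_conj`), and the same intertwining on two
factors transports the reflection equation (`IsReflectionMatrix.conj`). -/

namespace OpenChain

open Matrix

/-! ### Site operators, permutations and R-matrices in the tensor basis -/

section TensorPower

variable {S : Type} [Fintype S] [DecidableEq S] {N : ℕ}

/-- The tensor product `⨂_s A_s` of a family of matrices, as a multiplicative map. -/
def tensorHom : (S → Matrix (Fin N) (Fin N) ℂ) →* TensorOp S N where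
  toFun A := Matrix.of fun f g => ∏ s, A s (f s) (g s)
  map_one' := by
    ext f g
    simp only [Matrix.of_apply, Pi.one_apply, Matrix.one_apply]
    by_cases h : f = g
    · simp [h]
    · obtain ⟨s, hs⟩ := Function.ne_iff.mp h
      rw [if_neg h]
      exact Finset.prod_eq_zero (Finset.mem_univ s) (if_neg hs)
  map_mul' A B := by
    ext f g
    simp only [Matrix.of_apply, Pi.mul_apply, Matrix.mul_apply, Finset.prod_univ_sum,
      Fintype.piFinset_univ, Finset.prod_mul_distrib]

lemma tensorHom_apply (A : S → Matrix (Fin N) (Fin N) ℂ) (f g : S → Fin N) :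
    tensorHom A f g = ∏ s, A s (f s) (g s) := rfl

lemma siteOp_eq_tensorHom (s : S) (A : Matrix (Fin N) (Fin N) ℂ) :
    siteOp s A = tensorHom (Pi.mulSingle s A) := by
  ext f g
  rw [tensorHom_apply, siteOp, Matrix.of_apply, ← Finset.mul_prod_erase _ _ (Finset.mem_univ s),
    Pi.mulSingle_eq_same]
  split_ifs with h
  · rw [Finset.prod_eq_one, mul_one]
    intro t ht
    have hts := Finset.ne_of_mem_erase ht
    rw [Pi.mulSingle_eq_of_ne hts, h t hts, Matrix.one_apply_eq]
  · push Not at h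
    obtain ⟨t, hts, hfg⟩ := h
    rw [Finset.prod_eq_zero (Finset.mem_erase.mpr ⟨hts, Finset.mem_univ t⟩), mul_zero]
    rw [Pi.mulSingle_eq_of_ne hts, Matrix.one_apply_ne hfg]

lemma siteOp_mul (s : S) (A B : Matrix (Fin N) (Fin N) ℂ) :
    siteOp s (A * B) = siteOp s A * siteOp s B := by
  simp only [siteOp_eq_tensorHom, Pi.mulSingle_mul, map_mul]

lemma siteOp_commute {s t : S} (h : s ≠ t) (A B : Matrix (Fin N) (Fin N) ℂ) :
    siteOp s A * siteOp t B = siteOp t B * siteOp s A := by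
  rw [siteOp_eq_tensorHom, siteOp_eq_tensorHom]
  have hc : Commute (Pi.mulSingle s A : S → Matrix (Fin N) (Fin N) ℂ) (Pi.mulSingle t B) :=
    Pi.mulSingle_commute (f := fun _ : S => Matrix (Fin N) (Fin N) ℂ) h A B
  exact (hc.map tensorHom).eq

lemma siteOp_mul_tensorHom (s : S) {A B U : Matrix (Fin N) (Fin N) ℂ} (h : A * U = U * B) :
    siteOp s A * tensorHom (fun _ => U) = tensorHom (fun _ => U) * siteOp s B := by
  rw [siteOp_eq_tensorHom, siteOp_eq_tensorHom, ← map_mul, ← map_mul]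
  congr 1
  ext1 t
  by_cases hts : t = s
  · subst hts; simpa using h
  · simp [Pi.mulSingle_eq_of_ne hts]

/-- For given `f`, only the summand with `i = f s` and `j = f t` can be nonzero, so the double sum
collapses. -/
lemma permOp_apply {s t : S} (hst : s ≠ t) (f g : S → Fin N) :
    (permOp s t : TensorOp S N) f g = if f ∘ Equiv.swap s t = g then 1 else 0 := by
  have key : ∀ i j : Fin N,
      (siteOp s (Matrix.single i j (1 : ℂ)) * siteOp t (Matrix.single j i (1 : ℂ)) :
        TensorOp S N) f g =
      if i = f s then if j = f t then if f ∘ Equiv.swap s t = g then 1 else 0 else 0 else 0 := by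
    intro i j
    rw [siteOp_eq_tensorHom, siteOp_eq_tensorHom, ← map_mul, tensorHom_apply,
      ← Finset.mul_prod_erase _ _ (Finset.mem_univ s),
      ← Finset.mul_prod_erase _ _ (Finset.mem_erase.mpr ⟨hst.symm, Finset.mem_univ t⟩)]
    have hs : (Pi.mulSingle s (Matrix.single i j (1 : ℂ)) *
        Pi.mulSingle t (Matrix.single j i (1 : ℂ)) : S → Matrix (Fin N) (Fin N) ℂ) s =
        Matrix.single i j 1 := by simp [Pi.mulSingle_eq_of_ne hst]
    have ht : (Pi.mulSingle s (Matrix.single i j (1 : ℂ)) *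
        Pi.mulSingle t (Matrix.single j i (1 : ℂ)) : S → Matrix (Fin N) (Fin N) ℂ) t =
        Matrix.single j i 1 := by simp [Pi.mulSingle_eq_of_ne hst.symm]
    have hr : ∀ r, r ≠ s → r ≠ t → (Pi.mulSingle s (Matrix.single i j (1 : ℂ)) *
        Pi.mulSingle t (Matrix.single j i (1 : ℂ)) : S → Matrix (Fin N) (Fin N) ℂ) r = 1 := by
      intro r h1 h2; simp [Pi.mulSingle_eq_of_ne h1, Pi.mulSingle_eq_of_ne h2]
    rw [hs, ht]
    by_cases hi : i = f s
    swap
    · simp [Matrix.single_apply, hi]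
    by_cases hj : j = f t
    swap
    · simp [Matrix.single_apply, hj]
    rw [if_pos hi, if_pos hj]
    split_ifs with hg
    · subst hg
      rw [Finset.prod_eq_one]
      · simp [hi, hj]
      · intro r hmem
        simp only [Finset.mem_erase, Finset.mem_univ, and_true] at hmem
        rw [hr r hmem.2 hmem.1, Function.comp_apply, Equiv.swap_apply_of_ne_of_ne hmem.2 hmem.1,
          Matrix.one_apply_eq]
    · obtain ⟨r, hrg⟩ := Function.ne_iff.mp hg
      rw [Function.comp_apply] at hrg
      by_cases h1 : r = s
      · subst h1
        rw [Equiv.swap_apply_left, ← hj] at hrg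
        simp [Matrix.single_apply, hrg]
      by_cases h2 : r = t
      · subst h2
        rw [Equiv.swap_apply_right, ← hi] at hrg
        simp [Matrix.single_apply, hrg]
      rw [Equiv.swap_apply_of_ne_of_ne h1 h2] at hrg
      rw [Finset.prod_eq_zero (i := r) (by simp [h1, h2]), mul_zero, mul_zero]
      rw [hr r h1 h2, Matrix.one_apply_ne hrg]
  rw [permOp, Matrix.sum_apply]
  simp only [Matrix.sum_apply, key]
  simp

lemma permOp_mul_apply {s t : S} (hst : s ≠ t) (M : TensorOp S N) (f g : S → Fin N) :
    (permOp s t * M : TensorOp S N) f g = M (f ∘ Equiv.swap s t) g := by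
  simp [Matrix.mul_apply, permOp_apply hst]

lemma mul_permOp_apply {s t : S} (hst : s ≠ t) (M : TensorOp S N) (f g : S → Fin N) :
    (M * permOp s t : TensorOp S N) f g = M f (g ∘ Equiv.swap s t) := by
  have h : ∀ k : S → Fin N, k ∘ Equiv.swap s t = g ↔ k = g ∘ Equiv.swap s t := by
    intro k
    constructor <;> rintro rfl <;> ext x <;> simp
  simp [Matrix.mul_apply, permOp_apply hst, h]

lemma permOp_mul_tensorHom {s t : S} (hst : s ≠ t) (A : S → Matrix (Fin N) (Fin N) ℂ) :
    permOp s t * tensorHom (A ∘ Equiv.swap s t) = tensorHom A * permOp s t := by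
  ext f g
  rw [permOp_mul_apply hst, mul_permOp_apply hst, tensorHom_apply, tensorHom_apply]
  refine Fintype.prod_equiv (Equiv.swap s t) _ _ fun x => ?_
  simp

lemma permOp_mul_permOp {s t : S} (hst : s ≠ t) :
    (permOp s t * permOp s t : TensorOp S N) = 1 := by
  ext f g
  rw [permOp_mul_apply hst, permOp_apply hst, Matrix.one_apply]
  congr 2
  ext x; simp

lemma permOp_comm {s t : S} (hst : s ≠ t) : (permOp t s : TensorOp S N) = permOp s t := by
  ext f g
  rw [permOp_apply hst, permOp_apply hst.symm, Equiv.swap_comm]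

lemma siteOp_mul_permOp {s t : S} (hst : s ≠ t) (A : Matrix (Fin N) (Fin N) ℂ) :
    siteOp s A * permOp s t = permOp s t * siteOp t A := by
  rw [siteOp_eq_tensorHom, siteOp_eq_tensorHom, ← permOp_mul_tensorHom hst]
  congr 2
  ext1 x
  simp only [Function.comp_apply, Pi.mulSingle_apply, Equiv.swap_apply_eq_iff,
    Equiv.swap_apply_left]

/-- Permuting equal factors changes nothing; this is the `GL_N` symmetry of the R-matrix. -/
lemma rMatrix_commute_tensorHom {s t : S} (hst : s ≠ t) (u : ℂ)
    (U : Matrix (Fin N) (Fin N) ℂ) :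
    rMatrix s t u * tensorHom (fun _ => U) = tensorHom (fun _ => U) * rMatrix s t u := by
  have h := permOp_mul_tensorHom hst (fun _ : S => U)
  rw [rMatrix, add_mul, mul_add, smul_mul_assoc, smul_mul_assoc, mul_smul_comm, mul_smul_comm,
    one_mul, mul_one, ← h]
  rfl

lemma tensorHom_const_mul (A B : Matrix (Fin N) (Fin N) ℂ) :
    tensorHom (fun _ : S => A) * tensorHom (fun _ => B) = tensorHom (fun _ => A * B) :=
  (map_mul tensorHom (fun _ : S => A) (fun _ => B)).symm

lemma tensorHom_const_one :
    tensorHom (fun _ : S => (1 : Matrix (Fin N) (Fin N) ℂ)) = 1 :=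
  map_one tensorHom

end TensorPower

/-! ### Values of a reflection matrix commute -/

section Commutation

variable {N : ℕ} {K : ℂ → Matrix (Fin N) (Fin N) ℂ}

/-- The reflection equation after moving the permutation operators to the left. -/
lemma IsReflectionMatrix.expanded (hK : IsReflectionMatrix K) (x y : ℂ) :
    (Complex.I * (x - y)) • (permOp 0 1 * siteOp 1 (K x * K y) : TensorOp (Fin 2) N) +
        (Complex.I * (x + y)) • (permOp 0 1 * (siteOp 0 (K x) * siteOp 1 (K y))) -
        siteOp 1 (K x * K y) =
      (Complex.I * (x + y)) • (permOp 0 1 * (siteOp 0 (K y) * siteOp 1 (K x))) +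
        (Complex.I * (x - y)) • (permOp 0 1 * siteOp 0 (K y * K x)) - siteOp 1 (K y * K x) := by
  have h01 : (0 : Fin 2) ≠ 1 := by decide
  have h := hK x y
  have hsq := permOp_mul_permOp (N := N) h01
  have mv : ∀ A, (siteOp 0 A * permOp 0 1 : TensorOp (Fin 2) N) = permOp 0 1 * siteOp 1 A :=
    siteOp_mul_permOp h01
  have mv' : ∀ A, (siteOp 1 A * permOp 0 1 : TensorOp (Fin 2) N) = permOp 0 1 * siteOp 0 A := by
    intro A
    have := siteOp_mul_permOp h01.symm A
    rwa [permOp_comm h01] at this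
  have cm := siteOp_commute (N := N) h01
  simp only [rMatrix, permOp_comm h01] at h
  set P : TensorOp (Fin 2) N := permOp 0 1
  set a := siteOp (0 : Fin 2) (K x)
  set b := siteOp (1 : Fin 2) (K y)
  have l1 : (P * a * P * b : TensorOp (Fin 2) N) = siteOp 1 (K x * K y) := by
    rw [mul_assoc P, mv, ← mul_assoc, hsq, one_mul, siteOp_mul]
  have l2 : (a * P * b : TensorOp (Fin 2) N) = P * siteOp 1 (K x * K y) := by
    rw [mv, mul_assoc, siteOp_mul]
  have r1 : (P * siteOp 0 (K y * K x) * P : TensorOp (Fin 2) N) = siteOp 1 (K y * K x) := by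
    rw [mul_assoc, mv, ← mul_assoc, hsq, one_mul]
  have r2 : (b * P * a : TensorOp (Fin 2) N) = P * siteOp 0 (K y * K x) := by
    rw [mv', mul_assoc, siteOp_mul]
  have r3 : (b * a * P : TensorOp (Fin 2) N) = P * (siteOp 0 (K y) * siteOp 1 (K x)) := by
    rw [mul_assoc, mv, ← mul_assoc, mv', mul_assoc]
  simp only [add_mul, mul_add, smul_mul_assoc, mul_smul_comm, one_mul, mul_one, smul_add,
    smul_smul, l1, l2, r1, r2, r3, Complex.I_mul_I] at h
  rw [← cm (K x) (K y)] at h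
  rw [← mul_assoc P a b]
  rw [← sub_eq_zero] at h ⊢
  rw [← h]
  module

lemma IsReflectionMatrix.entry (hK : IsReflectionMatrix K) (x y : ℂ) (i j k l : Fin N) :
    Complex.I * (x - y) * ((1 : Matrix (Fin N) (Fin N) ℂ) i k * (K x * K y) j l) +
        Complex.I * (x + y) * (K x i k * K y j l) -
        (1 : Matrix (Fin N) (Fin N) ℂ) j k * (K x * K y) i l =
      Complex.I * (x + y) * (K y i k * K x j l) +
        Complex.I * (x - y) * ((K y * K x) i k * (1 : Matrix (Fin N) (Fin N) ℂ) j l) -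
        (1 : Matrix (Fin N) (Fin N) ℂ) j k * (K y * K x) i l := by
  have h01 : (0 : Fin 2) ≠ 1 := by decide
  -- The row index is written swapped so that the permutation operator on the left restores the
  -- order `![i, j]`.
  have h := congrFun (congrFun (hK.expanded x y) ![j, i]) ![k, l]
  have hsw : ![j, i] ∘ Equiv.swap (0 : Fin 2) 1 = ![i, j] := by
    ext r; fin_cases r <;> simp
  have h0 : ∀ (A : Matrix (Fin N) (Fin N) ℂ) (p q r s : Fin N),
      (siteOp 0 A : TensorOp (Fin 2) N) ![p, q] ![r, s] =
        A p r * (1 : Matrix (Fin N) (Fin N) ℂ) q s := by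
    intro A p q r s
    rw [siteOp_eq_tensorHom, tensorHom_apply, Fin.prod_univ_two, Pi.mulSingle_eq_same,
      Pi.mulSingle_eq_of_ne h01.symm]
    rfl
  have h1 : ∀ (A : Matrix (Fin N) (Fin N) ℂ) (p q r s : Fin N),
      (siteOp 1 A : TensorOp (Fin 2) N) ![p, q] ![r, s] =
        (1 : Matrix (Fin N) (Fin N) ℂ) p r * A q s := by
    intro A p q r s
    rw [siteOp_eq_tensorHom, tensorHom_apply, Fin.prod_univ_two, Pi.mulSingle_eq_same,
      Pi.mulSingle_eq_of_ne h01]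
    rfl
  have h2 : ∀ (A B : Matrix (Fin N) (Fin N) ℂ) (p q r s : Fin N),
      (siteOp 0 A * siteOp 1 B : TensorOp (Fin 2) N) ![p, q] ![r, s] = A p r * B q s := by
    intro A B p q r s
    rw [siteOp_eq_tensorHom, siteOp_eq_tensorHom, ← map_mul]
    simp [tensorHom_apply, Fin.prod_univ_two, Pi.mulSingle_apply]
  simpa only [Matrix.sub_apply, Matrix.add_apply, Matrix.smul_apply, smul_eq_mul,
    permOp_mul_apply h01, hsw, h0, h1, h2] using h

lemma IsReflectionMatrix.smul_commutator (hK : IsReflectionMatrix K) (x y : ℂ) :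
    ((x - y) * N + 2 * Complex.I) • (K x * K y - K y * K x) = 0 := by
  ext p q
  -- `e1` and `e2` are the two partial traces; `t` matches their full-trace terms.
  have e1 := Finset.sum_congr (rfl : (Finset.univ : Finset (Fin N)) = Finset.univ)
    fun i _ => hK.entry x y i p i q
  have e2 := Finset.sum_congr (rfl : (Finset.univ : Finset (Fin N)) = Finset.univ)
    fun j _ => hK.entry x y p j q j
  have t := Matrix.trace_mul_comm (K x) (K y)
  simp only [Finset.sum_add_distrib, Finset.sum_sub_distrib, ← Finset.mul_sum, ← Finset.sum_mul,
    Matrix.one_apply, ite_mul, mul_ite, one_mul, zero_mul, mul_one, mul_zero,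
    Finset.sum_ite_eq, Finset.sum_ite_eq', Finset.mem_univ, if_true, Finset.sum_const,
    Finset.card_univ, Fintype.card_fin, nsmul_eq_mul, Finset.sum_ite_irrel] at e1 e2
  simp only [Matrix.trace, Matrix.diag_apply] at t
  rw [t] at e2
  simp only [Matrix.smul_apply, Matrix.sub_apply, Matrix.zero_apply, smul_eq_mul]
  by_cases hpq : p = q
  · simp only [hpq, if_true] at e1 e2 ⊢
    -- The sum has coefficient `I * (x - y) * N - 2`; the factor `-I` turns it into the stated one.
    linear_combination (-Complex.I) * (e1 + e2) +
      (x - y) * N * ((K x * K y) q q - (K y * K x) q q) * Complex.I_mul_I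
  · simp only [hpq, if_false] at e1 e2 ⊢
    linear_combination (-Complex.I) * (e1 + e2) +
      (x - y) * N * ((K x * K y) p q - (K y * K x) p q) * Complex.I_mul_I

/-- The scalar factors at `(x, y)` and `(y, x)` sum to `4i`, so they cannot both vanish. -/
lemma IsReflectionMatrix.commute (hK : IsReflectionMatrix K) (x y : ℂ) :
    K x * K y = K y * K x := by
  rcases smul_eq_zero.mp (hK.smul_commutator x y) with h | h
  · rcases smul_eq_zero.mp (hK.smul_commutator y x) with h' | h'
    · have : (4 : ℂ) * Complex.I = 0 := by linear_combination h + h'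
      simp at this
    · exact (sub_eq_zero.mp h').symm
  · exact sub_eq_zero.mp h

end Commutation

/-! ### Simultaneous diagonalization -/

section Diagonalization

variable {N : ℕ}

/-- In diagonalizing coordinates `T - c` multiplies each coordinate by a scalar, and a scalar with a
vanishing power is zero. -/
lemma IsDiagonalizable.maxGenEigenspace_le {M : Matrix (Fin N) (Fin N) ℂ}
    (hM : IsDiagonalizable M) (c : ℂ) :
    Module.End.maxGenEigenspace (Matrix.toLin' M) c ≤
      Module.End.eigenspace (Matrix.toLin' M) c := by
  obtain ⟨Q, hQ⟩ := hM
  set P : Matrix (Fin N) (Fin N) ℂ :=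
    ((Q⁻¹ : GeneralLinearGroup (Fin N) ℂ) : Matrix (Fin N) (Fin N) ℂ)
  have hQP : (Q : Matrix (Fin N) (Fin N) ℂ) * P = 1 := Units.mul_inv Q
  set E := P * M * (Q : Matrix (Fin N) (Fin N) ℂ)
  have hPM : P * M = Matrix.diagonal E.diag * P := by
    rw [(Matrix.isDiag_iff_diagonal_diag E).mp hQ, mul_assoc, hQP, mul_one]
  set T : Module.End ℂ (Fin N → ℂ) := Matrix.toLin' M
  have hstep : ∀ w i, (P *ᵥ (T - c • (1 : Module.End ℂ (Fin N → ℂ))) w) i =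
      (E.diag i - c) * (P *ᵥ w) i := by
    intro w i
    have : (T - c • (1 : Module.End ℂ (Fin N → ℂ))) w = M *ᵥ w - c • w := rfl
    rw [this, Matrix.mulVec_sub, Matrix.mulVec_mulVec, hPM, ← Matrix.mulVec_mulVec,
      Matrix.mulVec_smul, Pi.sub_apply, Matrix.mulVec_diagonal, Pi.smul_apply, smul_eq_mul,
      sub_mul]
  have hpow : ∀ (k : ℕ) w i, (P *ᵥ ((T - c • (1 : Module.End ℂ (Fin N → ℂ))) ^ k) w) i =
      (E.diag i - c) ^ k * (P *ᵥ w) i := by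
    intro k
    induction k with
    | zero => intro w i; simp
    | succ k ih =>
      intro w i
      rw [pow_succ', Module.End.mul_apply, hstep, ih, pow_succ', mul_assoc]
  intro v hv
  obtain ⟨k, hk⟩ := (Module.End.mem_maxGenEigenspace _ _ _).mp hv
  have hz : P *ᵥ (T - c • (1 : Module.End ℂ (Fin N → ℂ))) v = 0 := by
    ext i
    have h := hpow k v i
    rw [hk, Matrix.mulVec_zero, Pi.zero_apply] at h
    rw [hstep, Pi.zero_apply]
    rcases mul_eq_zero.mp h.symm with h | h
    · rw [eq_zero_of_pow_eq_zero h, zero_mul]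
    · rw [h, mul_zero]
  have hz' : (T - c • (1 : Module.End ℂ (Fin N → ℂ))) v = 0 := by
    rw [← Matrix.one_mulVec ((T - c • (1 : Module.End ℂ (Fin N → ℂ))) v), ← hQP,
      ← Matrix.mulVec_mulVec, hz, Matrix.mulVec_zero]
  exact Module.End.mem_eigenspace_iff.mpr (sub_eq_zero.mp hz')

/-- A commuting family of diagonalizable matrices is simultaneously diagonalizable. -/
lemma exists_simultaneous_diagonalization {ι : Type} {K : ι → Matrix (Fin N) (Fin N) ℂ}
    (hcomm : ∀ x y, K x * K y = K y * K x) (hdiag : ∀ x, IsDiagonalizable (K x)) :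
    ∃ U : GeneralLinearGroup (Fin N) ℂ, ∀ x,
      (((U⁻¹ : GeneralLinearGroup (Fin N) ℂ) : Matrix (Fin N) (Fin N) ℂ) * K x *
        (U : Matrix (Fin N) (Fin N) ℂ)).IsDiag := by
  have htop := Module.End.iSup_iInf_maxGenEigenspace_eq_top_of_iSup_maxGenEigenspace_eq_top_of_commute
    (fun x => Matrix.toLin' (K x))
    (fun x y _ => by
      change Matrix.toLin' (K x) * Matrix.toLin' (K y) = Matrix.toLin' (K y) * Matrix.toLin' (K x)
      exact (Matrix.toLin'_mul _ _).symm.trans ((congrArg _ (hcomm x y)).trans (Matrix.toLin'_mul _ _)))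
    (fun x => Module.End.iSup_maxGenEigenspace_eq_top _)
  set E : Set (Fin N → ℂ) := {v | ∀ x, ∃ c : ℂ, K x *ᵥ v = c • v}
  have hE : ⊤ ≤ Submodule.span ℂ E := by
    -- Joint generalized eigenspaces span, and by diagonalizability they consist of joint
    -- eigenvectors. The family may be infinite.
    rw [← htop]
    refine iSup_le fun χ v hv => Submodule.subset_span fun x => ⟨χ x, ?_⟩
    have h := (hdiag x).maxGenEigenspace_le (χ x) ((Submodule.mem_iInf _).mp hv x)
    simpa using Module.End.mem_eigenspace_iff.mp h
  let b₀ := Module.Basis.ofSpan hE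
  have hb₀ : ∀ k, b₀ k ∈ E := fun k => Module.Basis.ofSpan_subset hE ⟨k, rfl⟩
  -- Reindexing by `Fin N` makes the change-of-basis matrix square.
  let b := b₀.reindex (b₀.indexEquiv (Pi.basisFun ℂ (Fin N)))
  have hb : ∀ k, b k ∈ E := fun k => by
    rw [Module.Basis.reindex_apply]
    exact hb₀ _
  let W : Matrix (Fin N) (Fin N) ℂ := (Pi.basisFun ℂ (Fin N)).toMatrix b
  let W' : Matrix (Fin N) (Fin N) ℂ := b.toMatrix (Pi.basisFun ℂ (Fin N))
  have hWW' : W * W' = 1 := Module.Basis.toMatrix_mul_toMatrix_flip _ _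
  have hW'W : W' * W = 1 := Module.Basis.toMatrix_mul_toMatrix_flip _ _
  refine ⟨⟨W, W', hWW', hW'W⟩, fun x => ?_⟩
  choose c hc using fun k => hb k x
  have hKW : K x * W = W * Matrix.diagonal c := by
    ext i k
    have h := congrFun (hc k) i
    rw [Matrix.mul_diagonal, mul_comm]
    exact h
  change (W' * K x * W).IsDiag
  rw [mul_assoc, hKW, ← mul_assoc, hW'W, one_mul]
  exact Matrix.isDiag_diagonal c

end Diagonalization

/-! ### Conjugating the transfer matrix and the reflection equation -/

section Chain

variable {N L : ℕ}

lemma chainOp_eq_tensorHom (U : Matrix (Fin N) (Fin N) ℂ) :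
    chainOp L U = tensorHom fun _ => U := by
  have h : (fun j : Fin L => (siteOp j U : TensorOp (Fin L) N)) =
      tensorHom ∘ fun j => Pi.mulSingle j U := by
    ext1 j
    exact siteOp_eq_tensorHom j U
  rw [chainOp, h, ← List.map_ofFn, ← map_list_prod]
  have hprod : (List.ofFn fun j : Fin L =>
      (Pi.mulSingle j U : Fin L → Matrix (Fin N) (Fin N) ℂ)).prod = fun _ => U := by
    ext1 s
    have he := map_list_prod (Pi.evalMonoidHom (fun _ : Fin L => Matrix (Fin N) (Fin N) ℂ) s)
      (List.ofFn fun j : Fin L => Pi.mulSingle j U)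
    rw [Pi.evalMonoidHom_apply] at he
    rw [he, List.map_ofFn, List.ofFn_eq_map, List.prod_map_eq_pow_single s]
    · simp [List.count_eq_one_of_mem (List.nodup_finRange L) (List.mem_finRange s)]
    · intro j hj _
      simp [Pi.mulSingle_eq_of_ne hj.symm]
  rw [hprod]

lemma tensorHom_const_cons (U : Matrix (Fin N) (Fin N) ℂ) (i j : Fin N) (f g : Fin L → Fin N) :
    (tensorHom (fun _ => U) : TensorOp (Fin (L + 1)) N)
        (Fin.cons (α := fun _ => Fin N) i f) (Fin.cons (α := fun _ => Fin N) j g) =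
      U i j * tensorHom (fun _ => U) f g := by
  simp [tensorHom_apply, Fin.prod_univ_succ]

lemma sum_fin_cons (F : (Fin (L + 1) → Fin N) → ℂ) :
    ∑ f, F f = ∑ i, ∑ f : Fin L → Fin N, F (Fin.cons (α := fun _ => Fin N) i f) := by
  rw [← Fintype.sum_prod_type']
  exact (Equiv.sum_comp (Fin.consEquiv fun _ => Fin N) F).symm

/-- Cyclicity of the trace in the auxiliary factor cancels `U` against `V` there; the chain factors
are untouched by the trace. -/
lemma auxTrace_conj {U V : Matrix (Fin N) (Fin N) ℂ} (hVU : V * U = 1)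
    (X : TensorOp (Fin (L + 1)) N) :
    auxTrace (tensorHom (fun _ => U) * X * tensorHom (fun _ => V)) =
      tensorHom (fun _ => U) * auxTrace X * tensorHom (fun _ => V) := by
  have hentry (a b : Fin N) : ∑ i, V a i * U i b = if a = b then 1 else 0 := by
    rw [← Matrix.mul_apply, hVU, Matrix.one_apply]
  ext f g
  simp only [auxTrace, Matrix.of_apply, Matrix.mul_apply, sum_fin_cons, tensorHom_const_cons]
  have step : ∀ (i b : Fin N) (k : Fin L → Fin N),
      (∑ a, ∑ h : Fin L → Fin N, U i a * tensorHom (fun _ => U) f h *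
        X (Fin.cons (α := fun _ => Fin N) a h) (Fin.cons (α := fun _ => Fin N) b k)) *
        (V b i * tensorHom (fun _ => V) k g) =
      ∑ a, (V b i * U i a) * ((∑ h : Fin L → Fin N, tensorHom (fun _ => U) f h *
        X (Fin.cons (α := fun _ => Fin N) a h) (Fin.cons (α := fun _ => Fin N) b k)) *
        tensorHom (fun _ => V) k g) := by
    intro i b k
    simp only [Finset.sum_mul, Finset.mul_sum]
    refine Finset.sum_congr rfl fun a _ => Finset.sum_congr rfl fun h _ => ?_
    ring
  simp only [step]
  -- The traced index is moved innermost, where `hentry` contracts `V` with `U`.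
  rw [Finset.sum_comm]
  rw [Finset.sum_congr rfl fun b _ => Finset.sum_comm]
  rw [Finset.sum_congr rfl fun b _ => Finset.sum_congr rfl fun k _ => Finset.sum_comm]
  simp only [← Finset.sum_mul, hentry, ite_mul, one_mul, zero_mul, Finset.sum_ite_eq,
    Finset.mem_univ, if_true]
  rw [Finset.sum_comm]
  refine Finset.sum_congr rfl fun k _ => ?_
  rw [← Finset.sum_mul, Finset.sum_comm]
  simp only [Finset.mul_sum]

lemma prod_ofFn_commute {M : Type*} [Monoid M] {n : ℕ} {F : Fin n → M} {V : M}
    (h : ∀ j, F j * V = V * F j) : (List.ofFn F).prod * V = V * (List.ofFn F).prod := by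
  refine Commute.list_prod_left _ _ fun x hx => ?_
  obtain ⟨j, rfl⟩ := (List.mem_ofFn' _ _).mp hx
  exact h j

lemma transfer_conj {K D : ℂ → Matrix (Fin N) (Fin N) ℂ} {U V : Matrix (Fin N) (Fin N) ℂ}
    (hUV : U * V = 1) (hVU : V * U = 1) (u : ℂ) (h : K u * U = U * D u) :
    transfer L K u = tensorHom (fun _ => U) * transfer L D u * tensorHom (fun _ => V) := by
  rw [transfer, transfer, ← auxTrace_conj hVU]
  congr 1
  have h1 : monodromy L u * tensorHom (fun _ => U) = tensorHom (fun _ => U) * monodromy L u :=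
    prod_ofFn_commute fun j => rMatrix_commute_tensorHom (Fin.succ_ne_zero _).symm u U
  have h2 : monodromyHat L u * tensorHom (fun _ => U) =
      tensorHom (fun _ => U) * monodromyHat L u :=
    prod_ofFn_commute fun j => rMatrix_commute_tensorHom (Fin.succ_ne_zero _) u U
  have hW : (tensorHom (fun _ => U) * tensorHom (fun _ => V) : TensorOp (Fin (L + 1)) N) = 1 := by
    rw [tensorHom_const_mul, hUV, tensorHom_const_one]
  rw [← mul_assoc, ← mul_assoc, ← h1, mul_assoc (monodromy L u) (tensorHom _),
    ← siteOp_mul_tensorHom 0 h, ← mul_assoc, mul_assoc _ (tensorHom _) (monodromyHat L u), ← h2,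
    ← mul_assoc, mul_assoc _ (tensorHom _) (tensorHom _), hW, mul_one]

lemma IsReflectionMatrix.conj {K D : ℂ → Matrix (Fin N) (Fin N) ℂ}
    (hK : IsReflectionMatrix K) {U V : Matrix (Fin N) (Fin N) ℂ}
    (hVU : V * U = 1) (h : ∀ u, K u * U = U * D u) : IsReflectionMatrix D := by
  intro x y
  have h01 : (0 : Fin 2) ≠ 1 := by decide
  have hW : (tensorHom (fun _ => V) * tensorHom (fun _ => U) : TensorOp (Fin 2) N) = 1 := by
    rw [tensorHom_const_mul, hVU, tensorHom_const_one]
  have hR := fun u => rMatrix_commute_tensorHom h01 u U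
  have hR' := fun u => rMatrix_commute_tensorHom h01.symm u U
  have hS := fun (s : Fin 2) u => siteOp_mul_tensorHom s (h u)
  -- `U ⊗ U` is pushed leftwards through each factor, turning `K` into `D`, until it meets `V ⊗ V`.
  have hxy := congrArg (fun Z => tensorHom (fun _ => V) * (Z * tensorHom (fun _ => U))) (hK x y)
  simp only [mul_assoc, hR', hS] at hxy
  have e : ∀ (A B : TensorOp (Fin 2) N), A * tensorHom (fun _ => U) = tensorHom (fun _ => U) * B →
      ∀ C, A * (tensorHom (fun _ => U) * C) = tensorHom (fun _ => U) * (B * C) := by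
    intro A B hAB C
    rw [← mul_assoc, hAB, mul_assoc]
  simp only [e _ _ (hR _), e _ _ (hR' _), e _ _ (hS _ _)] at hxy
  simp only [← mul_assoc, hW, one_mul] at hxy
  exact hxy

end Chain

/-! ### Eigenvectors under similarity -/

section Eigenvectors

variable {n : Type*} [Fintype n] [DecidableEq n]

lemma hasEigenvector_conj_iff {A B W W' : Matrix n n ℂ} (hW : W * W' = 1) (hW' : W' * W = 1)
    (hA : A = W * B * W') (μ : ℂ) (v : n → ℂ) :
    Module.End.HasEigenvector (Matrix.toLin' A) μ v ↔
      ∃ w, Module.End.HasEigenvector (Matrix.toLin' B) μ w ∧ v = W *ᵥ w := by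
  simp only [Module.End.hasEigenvector_iff, Module.End.mem_eigenspace_iff, Matrix.toLin'_apply]
  constructor
  · rintro ⟨h, hv⟩
    have hv' : v = W *ᵥ (W' *ᵥ v) := by rw [Matrix.mulVec_mulVec, hW, Matrix.one_mulVec]
    refine ⟨W' *ᵥ v, ⟨?_, fun h0 => hv (by rw [hv', h0, Matrix.mulVec_zero])⟩, hv'⟩
    rw [← Matrix.mulVec_smul, ← h, hA, Matrix.mulVec_mulVec, Matrix.mulVec_mulVec,
      ← mul_assoc, ← mul_assoc, hW', one_mul]
  · rintro ⟨w, ⟨h, hw⟩, rfl⟩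
    refine ⟨?_, fun h0 => hw ?_⟩
    · rw [hA, Matrix.mulVec_mulVec, mul_assoc, hW', mul_one, ← Matrix.mulVec_mulVec, h,
        Matrix.mulVec_smul]
    · rw [← Matrix.one_mulVec w, ← hW', ← Matrix.mulVec_mulVec, h0, Matrix.mulVec_zero]

lemma hasEigenvalue_conj_iff {A B W W' : Matrix n n ℂ} (hW : W * W' = 1) (hW' : W' * W = 1)
    (hA : A = W * B * W') (μ : ℂ) :
    Module.End.HasEigenvalue (Matrix.toLin' A) μ ↔
      Module.End.HasEigenvalue (Matrix.toLin' B) μ := by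
  constructor
  · intro h
    obtain ⟨v, hv⟩ := h.exists_hasEigenvector
    obtain ⟨w, hw, -⟩ := (hasEigenvector_conj_iff hW hW' hA μ v).mp hv
    exact Module.End.hasEigenvalue_of_hasEigenvector hw
  · intro h
    obtain ⟨w, hw⟩ := h.exists_hasEigenvector
    exact Module.End.hasEigenvalue_of_hasEigenvector
      ((hasEigenvector_conj_iff hW hW' hA μ _).mpr ⟨w, hw, rfl⟩)

end Eigenvectors

end OpenChain

theorem proposition1 (N L : ℕ) (K : ℂ → Matrix (Fin N) (Fin N) ℂ)
    (hK : OpenChain.IsReflectionMatrix K)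
    (hdiag : ∀ u : ℂ, OpenChain.IsDiagonalizable (K u)) :
    (∃ U : Matrix.GeneralLinearGroup (Fin N) ℂ, ∀ u : ℂ,
      (((U⁻¹ : Matrix.GeneralLinearGroup (Fin N) ℂ) : Matrix (Fin N) (Fin N) ℂ) * K u *
        (U : Matrix (Fin N) (Fin N) ℂ)).IsDiag) ∧
    ∀ (U : Matrix.GeneralLinearGroup (Fin N) ℂ) (D : ℂ → Matrix (Fin N) (Fin N) ℂ),
      (∀ u : ℂ, D u =
        ((U⁻¹ : Matrix.GeneralLinearGroup (Fin N) ℂ) : Matrix (Fin N) (Fin N) ℂ) * K u *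
          (U : Matrix (Fin N) (Fin N) ℂ)) →
      (∀ u : ℂ, (D u).IsDiag) →
      OpenChain.IsReflectionMatrix D ∧
      IsUnit (OpenChain.chainOp L (U : Matrix (Fin N) (Fin N) ℂ)) ∧
      ∀ u : ℂ,
        OpenChain.transfer L K u =
          OpenChain.chainOp L (U : Matrix (Fin N) (Fin N) ℂ) * OpenChain.transfer L D u *
            (OpenChain.chainOp L (U : Matrix (Fin N) (Fin N) ℂ))⁻¹ ∧
        (∀ μ : ℂ,
          Module.End.HasEigenvalue (Matrix.toLin' (OpenChain.transfer L K u)) μ ↔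
            Module.End.HasEigenvalue (Matrix.toLin' (OpenChain.transfer L D u)) μ) ∧
        (∀ (μ : ℂ) (v : (Fin L → Fin N) → ℂ),
          Module.End.HasEigenvector (Matrix.toLin' (OpenChain.transfer L K u)) μ v ↔
            ∃ w : (Fin L → Fin N) → ℂ,
              Module.End.HasEigenvector (Matrix.toLin' (OpenChain.transfer L D u)) μ w ∧
                v = (OpenChain.chainOp L (U : Matrix (Fin N) (Fin N) ℂ)).mulVec w) := by
  refine ⟨OpenChain.exists_simultaneous_diagonalization hK.commute hdiag, ?_⟩
  intro U D hD _
  set V : Matrix (Fin N) (Fin N) ℂ :=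
    ((U⁻¹ : Matrix.GeneralLinearGroup (Fin N) ℂ) : Matrix (Fin N) (Fin N) ℂ)
  have hUV : (U : Matrix (Fin N) (Fin N) ℂ) * V = 1 := Units.mul_inv U
  have hVU : V * (U : Matrix (Fin N) (Fin N) ℂ) = 1 := Units.inv_mul U
  have hKD : ∀ u, K u * (U : Matrix (Fin N) (Fin N) ℂ) = U * D u := by
    intro u
    rw [hD u, ← mul_assoc, ← mul_assoc, hUV, one_mul]
  have hW : OpenChain.chainOp L (U : Matrix (Fin N) (Fin N) ℂ) *
      OpenChain.tensorHom (fun _ => V) = 1 := by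
    rw [OpenChain.chainOp_eq_tensorHom, OpenChain.tensorHom_const_mul, hUV,
      OpenChain.tensorHom_const_one]
  have hW' : OpenChain.tensorHom (fun _ => V) *
      OpenChain.chainOp L (U : Matrix (Fin N) (Fin N) ℂ) = 1 := by
    rw [OpenChain.chainOp_eq_tensorHom, OpenChain.tensorHom_const_mul, hVU,
      OpenChain.tensorHom_const_one]
  refine ⟨hK.conj hVU hKD, ⟨⟨_, _, hW, hW'⟩, rfl⟩, fun u => ?_⟩
  have ht : OpenChain.transfer L K u = OpenChain.chainOp L (U : Matrix (Fin N) (Fin N) ℂ) *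
      OpenChain.transfer L D u * OpenChain.tensorHom (fun _ => V) := by
    rw [OpenChain.chainOp_eq_tensorHom]
    exact OpenChain.transfer_conj hUV hVU u (hKD u)
  refine ⟨?_, OpenChain.hasEigenvalue_conj_iff hW hW' ht,
    OpenChain.hasEigenvector_conj_iff hW hW' ht⟩
  rw [Matrix.inv_eq_right_inv hW]
  exact ht
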